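/- Let $(V,\otimes,k)$ be a commutative quantale: a complete lattice with a commutative, associative multiplication $\otimes$ that preserves suprema in each variable and has neutral element $k$. The $V$-powerset monad $(P_V,u,n)$ on $\mathtt{Set}$ is given by $P_V(X)=V^X$, $P_V(f)(\phi)(y)=\bigvee_{f(x)=y}\phi(x)$, $u_X(x)(x')=k$ if $x=x'$ and $\bot$ otherwise, and $n_X(\Phi)(x)=\bigvee_{\phi\in V^X}\Phi(\phi)\otimes\phi(x)$. Write $\mathtt{Set}^{P_V}$ for its category of Eilenberg–Moore algebras, and $(\phi\boxtimes\psi)(x,y)=\phi(x)\otimes\psi(y)$ for $\phi\in V^X$, $\psi\in V^Y$. 1. With respect to the cartesian monoidal structure of $\mathtt{Set}$, the maps $\mathtt{st}_{X,Y}:X\times P_V(Y)\to P_V(X\times Y)$, $(x,\phi)\mapsto u_X(x)\boxtimes\phi$, form a strength for $P_V$: they are natural in $X$ and $Y$ and compatible with the left unitor and the associator of $\mathtt{Set}$ and with $u$ and $n$. With $\mathtt{st}'_{X,Y}:P_V(X)\times Y\to P_V(X\times Y)$ obtained from $\mathtt{st}_{Y,X}$ by conjugating with the symmetry, this strong monad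 is commutative, that is, $$n_{X\times Y}\cdot P_V(\mathtt{st}'_{X,Y})\cdot \mathtt{st}_{P_V X,Y}=n_{X\times Y}\cdot P_V(\mathtt{st}_{X,Y})\cdot \mathtt{st}'_{X,P_V Y}=:\mathtt{dst}_{X,Y}:P_V(X)\times P_V(Y)\to P_V(X\times Y).$$ 2. The category $\mathtt{Set}^{P_V}$ admits a symmetric closed monoidal structure $\otimes_{P_V}$ whose unit is the free algebra $(P_V(1),n_1)$; evaluation at the point is an isomorphism of algebras from it to $V$ with structure map $\phi\mapsto\bigvee_{v\in V}\phi(v)\otimes v$. 3. The tensor product classifies bimorphisms. For algebras $(X,\alpha)$, $(Y,\beta)$, $(Z,\gamma)$, a function $f:X\times Y\to Z$ is a bimorphism if $$\gamma\cdot P_V(f)\cdot\mathtt{st}_{X,Y}=f\cdot(\mathrm{Id}_X\times\beta)\quad\text{and}\quad \gamma\cdot P_V(f)\cdot\mathtt{st}'_{X,Y}=f\cdot(\alpha\times\mathrm{Id}_Y).$$ There is a bijection $\mathtt{Set}^{P_V}(X\otimes_{P_V}Y,Z)\simeq\mathtt{Bim}(X\times Y,Z)$, natural in $Z$, given by composition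 with a universal bimorphism $\pi_{X,Y}:X\times Y\to X\otimes_{P_V}Y$ that is natural in $X$ and $Y$. The associator and the symmetry of $\otimes_{P_V}$ are those induced through $\pi$ by the associator and the symmetry of $\mathtt{Set}$; the left unitor at $(X,\alpha)$ corresponds to the bimorphism $P_V(1)\times X\xrightarrow{\mathtt{st}'_{1,X}}P_V(1\times X)\simeq P_V(X)\xrightarrow{\alpha}X$, and the right unitor to $X\times P_V(1)\xrightarrow{\mathtt{st}_{X,1}}P_V(X\times 1)\simeq P_V(X)\xrightarrow{\alpha}X$. 4. The free functor $\mathtt{Set}\to\mathtt{Set}^{P_V}$, $X\mapsto(P_V(X),n_X)$, is strong monoidal: its unit constraint is the identity, and its multiplication constraint $\mu_{X,Y}: P_V(X)\otimes_{P_V}P_V(Y)\simeq P_V(X\times Y)$ is the morphism corresponding to the bimorphism $\mathtt{dst}_{X,Y}$. -/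

import Mathlib

open CategoryTheory MonoidalCategory

universe v₁ u₁ u

/-! ### Strong and commutative monads, bimorphisms -/

section StrongMonads

variable {C : Type u₁} [Category.{v₁} C] [MonoidalCategory C]

/-- A strength on a monad `T` on a monoidal category: a natural family of maps
`X ⊗ T Y ⟶ T (X ⊗ Y)` compatible with the left unitor, the associator, and the unit and
multiplication of `T`. A strong monad is a monad with a strength. -/
structure MonadStrength (T : Monad C) where
  /-- The components of the strength. -/
  st (X Y : C) : X ⊗ T.obj Y ⟶ T.obj (X ⊗ Y)
  naturality {X X' Y Y' : C} (f : X ⟶ X') (g : Y ⟶ Y') :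
    (f ⊗ₘ T.map g) ≫ st X' Y' = st X Y ≫ T.map (f ⊗ₘ g)
  leftUnitor (Y : C) : st (𝟙_ C) Y ≫ T.map (λ_ Y).hom = (λ_ (T.obj Y)).hom
  associator (X Y Z : C) :
    st (X ⊗ Y) Z ≫ T.map (α_ X Y Z).hom =
      (α_ X Y (T.obj Z)).hom ≫ (X ◁ st Y Z) ≫ st X (Y ⊗ Z)
  unit (X Y : C) : (X ◁ T.η.app Y) ≫ st X Y = T.η.app (X ⊗ Y)
  mul (X Y : C) :
    (X ◁ T.μ.app Y) ≫ st X Y =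
      st X (T.obj Y) ≫ T.map (st X Y) ≫ T.μ.app (X ⊗ Y)

namespace MonadStrength

variable {T : Monad C} (S : MonadStrength T)

section Braided

variable [BraidedCategory C]

/-- The co-strength `T X ⊗ Y ⟶ T (X ⊗ Y)` obtained from the strength by means of the braiding. -/
def costrength (X Y : C) : T.obj X ⊗ Y ⟶ T.obj (X ⊗ Y) :=
  (β_ (T.obj X) Y).hom ≫ S.st Y X ≫ T.map (β_ Y X).hom

/-- The double strength `T X ⊗ T Y ⟶ T (X ⊗ Y)`. -/
def dst (X Y : C) : T.obj X ⊗ T.obj Y ⟶ T.obj (X ⊗ Y) :=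
  S.st (T.obj X) Y ≫ T.map (S.costrength X Y) ≫ T.μ.app (X ⊗ Y)

/-- A strong monad is commutative if the two canonical maps
`T X ⊗ T Y ⟶ T (X ⊗ Y)` coincide. -/
def IsCommutative : Prop :=
  ∀ X Y : C,
    S.st (T.obj X) Y ≫ T.map (S.costrength X Y) ≫ T.μ.app (X ⊗ Y) =
      S.costrength X (T.obj Y) ≫ T.map (S.st X Y) ≫ T.μ.app (X ⊗ Y)

/-- Bimorphisms `X ⊗ Y ⟶ Z` for algebras `X`, `Y`, `Z` of a strong monad. -/
structure IsBimorphism {X Y Z : T.Algebra} (f : X.A ⊗ Y.A ⟶ Z.A) : Prop where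
  right : S.st X.A Y.A ≫ T.map f ≫ Z.a = (X.A ◁ Y.a) ≫ f
  left : S.costrength X.A Y.A ≫ T.map f ≫ Z.a = (X.a ▷ Y.A) ≫ f

theorem IsBimorphism.comp {X Y Z W : T.Algebra} {f : X.A ⊗ Y.A ⟶ Z.A}
    (hf : S.IsBimorphism f) (g : Z ⟶ W) :
    S.IsBimorphism (X := X) (Y := Y) (Z := W) (f ≫ g.f) where
  right := by
    rw [Functor.map_comp, Category.assoc, g.h, ← Category.assoc (T.map f), ← Category.assoc,
      hf.right, Category.assoc]
  left := by
    rw [Functor.map_comp, Category.assoc, g.h, ← Category.assoc (T.map f), ← Category.assoc,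
      hf.left, Category.assoc]

/-- The functor sending an algebra `Z` to the set of bimorphisms `X ⊗ Y ⟶ Z`, acting on algebra
morphisms by composition. -/
def bim (X Y : T.Algebra) : T.Algebra ⥤ Type v₁ where
  obj Z := {f : X.A ⊗ Y.A ⟶ Z.A // S.IsBimorphism f}
  map g := ↾fun f => ⟨f.1 ≫ g.f, f.2.comp S g⟩
  map_id Z := by
    ext f
    exact Category.comp_id f.1
  map_comp g h := by
    ext f
    exact (Category.assoc f.1 g.f h.f).symm

end Braided

end MonadStrength

end StrongMonads

/-! ### The `V`-powerset monad -/

/-- The unit: the transpose of the diagonal, `vUnit V x x' = k` if `x = x'` and `⊥` otherwise. -/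
noncomputable def vUnit (V : Type u) [CommMonoid V] [CompleteLattice V] {X : Type u} (x : X) :
    X → V :=
  open Classical in fun x' => if x = x' then 1 else ⊥

/-- The direct image: `vMap V f φ y` is the supremum of `φ x` over the `x` with `f x = y`. -/
def vMap (V : Type u) [CompleteLattice V] {X Y : Type u} (f : X → Y) (φ : X → V) : Y → V :=
  fun y => ⨆ (x : X) (_ : f x = y), φ x

/-- The multiplication: `vMul V Φ x` is the supremum of `Φ φ ⊗ φ x` over all `φ : X → V`. -/
def vMul (V : Type u) [CommMonoid V] [CompleteLattice V] {X : Type u} (Φ : (X → V) → V) :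
    X → V :=
  fun x => ⨆ φ : X → V, Φ φ * φ x

/-- `(φ ⊠ ψ) (x, y) = φ x ⊗ ψ y`. -/
def vBox (V : Type u) [CommMonoid V] {X Y : Type u} (φ : X → V) (ψ : Y → V) : X × Y → V :=
  fun p => φ p.1 * ψ p.2

section VPowerset

theorem vMap_id {V : Type u} [CompleteLattice V] {X : Type u} (φ : X → V) : vMap V (fun x => x) φ = φ := by
  funext y
  simp [vMap]

theorem vMap_comp {V : Type u} [CompleteLattice V] {X Y Z : Type u} (f : X → Y) (g : Y → Z) (φ : X → V) :
    vMap V (fun x => g (f x)) φ = vMap V g (vMap V f φ) := by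
  funext z
  simp only [vMap]
  apply le_antisymm
  · refine iSup₂_le fun x hx => ?_
    exact le_iSup₂_of_le (f x) hx (le_iSup₂_of_le x rfl le_rfl)
  · refine iSup₂_le fun y hy => iSup₂_le fun x hx => ?_
    exact le_iSup₂_of_le x (by rw [hx, hy]) le_rfl

theorem vMap_unit {V : Type u} [CommMonoid V] [CompleteLattice V] {X Y : Type u} (f : X → Y) (x : X) :
    vMap V f (vUnit V x) = vUnit V (f x) := by
  funext y
  simp only [vMap, vUnit]
  apply le_antisymm
  · refine iSup₂_le fun x' hx' => ?_
    by_cases h : x = x'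
    · subst h; simp [hx']
    · simp [h]
  · by_cases h : f x = y
    · exact le_iSup₂_of_le x h (by simp [h])
    · simp [h]

variable {V : Type u} [CommMonoid V] [CompleteLattice V] [IsQuantale V]

theorem v_iSup_prop_mul (p : Prop) (a b : V) : (⨆ _ : p, a) * b = ⨆ _ : p, a * b := by
  by_cases h : p <;> simp [h]

theorem v_mul_iSup_prop (p : Prop) (a b : V) : (a * ⨆ _ : p, b) = ⨆ _ : p, a * b := by
  by_cases h : p <;> simp [h]

theorem v_iSup_map_mul {I J : Type u} (g : I → J) (a : I → V) (b : J → V) :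
    (⨆ j, vMap V g a j * b j) = ⨆ i, a i * b (g i) := by
  simp only [vMap, Quantale.iSup_mul_distrib, v_iSup_prop_mul]
  rw [iSup_comm]
  refine iSup_congr fun i => ?_
  apply le_antisymm
  · refine iSup_le fun j => iSup_le fun h => ?_
    rw [h]
  · exact le_iSup₂_of_le (g i) rfl le_rfl

theorem v_iSup_unit_mul {I : Type u} (i : I) (b : I → V) :
    (⨆ j, vUnit V i j * b j) = b i := by
  apply le_antisymm
  · refine iSup_le fun j => ?_
    by_cases h : i = j
    · subst h; simp [vUnit]
    · simp [vUnit, h]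
  · exact le_iSup_of_le i (by simp [vUnit])

theorem v_iSup_mul_unit {I : Type u} (i : I) (b : I → V) :
    (⨆ j, b j * vUnit V j i) = b i := by
  apply le_antisymm
  · refine iSup_le fun j => ?_
    by_cases h : j = i
    · subst h; simp [vUnit]
    · simp [vUnit, h]
  · exact le_iSup_of_le i (by simp [vUnit])

theorem v_iSup_mul_mul {I J : Type u} (a : I → V) (b : I → J → V) (c : J → V) :
    (⨆ j, (⨆ i, a i * b i j) * c j) = ⨆ i, a i * ⨆ j, b i j * c j := by
  simp only [Quantale.iSup_mul_distrib, Quantale.mul_iSup_distrib, mul_assoc]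
  exact iSup_comm

theorem vMap_vMul {X Y : Type u} (f : X → Y) (Φ : (X → V) → V) :
    vMap V f (vMul V Φ) = vMul V (vMap V (vMap V f) Φ) := by
  funext y
  refine Eq.trans ?_ (v_iSup_map_mul (vMap V f) Φ fun ψ => ψ y).symm
  simp only [vMap, vMul, Quantale.mul_iSup_distrib, v_mul_iSup_prop]
  apply le_antisymm
  · refine iSup₂_le fun x hx => iSup_le fun φ => ?_
    exact le_iSup_of_le φ (le_iSup₂_of_le x hx le_rfl)
  · refine iSup_le fun φ => iSup₂_le fun x hx => ?_
    exact le_iSup₂_of_le x hx (le_iSup_of_le φ le_rfl)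

/-- The `V`-powerset functor, `X ↦ V ^ X`. -/
def vPowersetFunctor (V : Type u) [CompleteLattice V] : Type u ⥤ Type u where
  obj X := X → V
  map f := ↾(vMap V f)
  map_id X := by
    refine ConcreteCategory.hom_ext _ _ fun φ => ?_
    exact vMap_id φ
  map_comp f g := by
    refine ConcreteCategory.hom_ext _ _ fun φ => ?_
    exact vMap_comp f g φ

/-- The `V`-powerset monad. -/
noncomputable def vPowersetMonad (V : Type u) [CommMonoid V] [CompleteLattice V] [IsQuantale V] :
    Monad (Type u) where
  toFunctor := vPowersetFunctor V
  η :=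
    { app := fun X => ↾(fun x : X => vUnit V x)
      naturality := fun X Y f => by
        ext x
        exact (vMap_unit f x).symm }
  μ :=
    { app := fun X => ↾(fun Φ : (X → V) → V => vMul V Φ)
      naturality := fun X Y f => by
        ext Φ
        exact (vMap_vMul f Φ).symm }
  assoc X := by
    ext Ψ
    funext x
    exact (v_iSup_map_mul (V := V) (vMul V) Ψ fun ψ => ψ x).trans
      (v_iSup_mul_mul Ψ (fun Φ φ => Φ φ) fun φ => φ x).symm
  left_unit X := by
    ext φ
    funext x
    exact v_iSup_unit_mul (V := V) φ fun ψ => ψ x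
  right_unit X := by
    ext φ
    funext x
    exact (v_iSup_map_mul (V := V) (vUnit V) φ fun ψ => ψ x).trans (v_iSup_mul_unit x φ)

/-- The quantale `V` as an algebra of the `V`-powerset monad: the structure map sends
`φ : V → V` to the supremum of the elements `φ v ⊗ v`. -/
noncomputable def vSelfAlgebra (V : Type u) [CommMonoid V] [CompleteLattice V] [IsQuantale V] :
    (vPowersetMonad V).Algebra where
  A := V
  a := ↾(fun φ : V → V => ⨆ v : V, φ v * v)
  unit := by
    ext v
    exact v_iSup_unit_mul (V := V) v fun w => w
  assoc := by
    ext Φ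
    exact (v_iSup_mul_mul Φ (fun φ v => φ v) fun v => v).trans
      (v_iSup_map_mul (fun φ : V → V => ⨆ v : V, φ v * v) Φ fun w => w).symm

end VPowerset

/-! The argument uses only that the monad `T` is commutative, so it is carried out for any such
monad on types. Elements of `T I` are read as formal combinations of elements of `I`, and `Z.extend
f φ` evaluates such a combination in an algebra `Z`. Commutativity then becomes a Fubini rule,
`extend_comm`: two nested evaluations may be interchanged.

The tensor product is `T (X × Y)` modulo the intersection of the kernels of all bilinear maps. Lifts
of bilinear maps are therefore jointly injective (`tensor_eq_of_lift`), so an identity in the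
quotient may be checked in an arbitrary algebra after an arbitrary lift; this gives the algebra laws
and the bilinearity of `tmul` without commutativity. Pure tensors generate (`tensor_mk_eq`), so
morphisms out of a tensor product are determined on them, and each coherence law reduces to an
identity between pure tensors.

The Fubini rule enters through `IsAlgHom.pointwise`: a pointwise combination of homomorphisms is
again a homomorphism. This makes the maps defining the associator and the unit action bilinear,
gives the morphisms `Y ⟶ Z` an algebra structure that is right adjoint to the tensor product, and
makes `T I × T J → T (I × J)` bilinear. Freeness supplies the inverse of the last map on the tensor
product.

For the canonical strength on types, bimorphisms are exactly bilinear maps. For the `V`-powerset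
monad, both double strengths equal `φ ⊠ ψ`, because `⊗` distributes over suprema and is commutative.
-/

namespace CategoryTheory.Monad

variable {T : Monad (Type u)}

/-! ### Evaluating formal combinations in an algebra -/

namespace Algebra

/-- The extension of a function `f : I → Z` to `T I`, by means of the structure map of `Z`. -/
def extend (Z : T.Algebra) {I : Type u} (f : I → Z.A) (φ : T.obj I) : Z.A :=
  Z.a (T.map (↾f) φ)

theorem extend_unit (Z : T.Algebra) {I : Type u} (f : I → Z.A) (i : I) :
    Z.extend f (T.η.app I i) = f i := by
  have h := ConcreteCategory.congr_hom (T.η.naturality (↾f)) i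
  have h' := ConcreteCategory.congr_hom Z.unit (f i)
  exact (congrArg Z.a h.symm).trans h'

theorem extend_map (Z : T.Algebra) {I J : Type u} (g : I ⟶ J) (f : J → Z.A) (φ : T.obj I) :
    Z.extend f (T.map g φ) = Z.extend (fun i => f (g i)) φ :=
  congrArg Z.a (ConcreteCategory.congr_hom (T.map_comp g (↾f)) φ).symm

theorem extend_self (Z : T.Algebra) (φ : T.obj Z.A) : Z.extend (fun z => z) φ = Z.a φ :=
  congrArg Z.a (ConcreteCategory.congr_hom (T.map_id Z.A) φ)

theorem extend_mul (Z : T.Algebra) {I : Type u} (f : I → Z.A) (Φ : T.obj (T.obj I)) :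
    Z.extend f (T.μ.app I Φ) = Z.extend (Z.extend f) Φ := by
  have h := ConcreteCategory.congr_hom (T.μ.naturality (↾f)) Φ
  have h' := ConcreteCategory.congr_hom Z.assoc (T.map (T.map (↾f)) Φ)
  have h'' := ConcreteCategory.congr_hom (T.map_comp (T.map (↾f)) Z.a) Φ
  exact ((congrArg Z.a h.symm).trans h').trans (congrArg Z.a h''.symm)

/-- A function between the carriers of two algebras is a homomorphism if it commutes with the
structure maps. -/
def IsAlgHom (X Y : T.Algebra) (h : X.A → Y.A) : Prop :=
  ∀ φ : T.obj X.A, h (X.a φ) = Y.extend h φ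

theorem Hom.isAlgHom {X Y : T.Algebra} (g : X ⟶ Y) : IsAlgHom X Y fun x => g.f x :=
  fun φ => (ConcreteCategory.congr_hom g.h φ).symm

/-- The morphism of algebras given by a function that is a homomorphism. -/
def IsAlgHom.toHom {X Y : T.Algebra} {h : X.A → Y.A} (hh : IsAlgHom X Y h) : X ⟶ Y where
  f := ↾h
  h := by
    ext φ
    exact (hh φ).symm

theorem hom_ext_apply {X Y : T.Algebra} {g g' : X ⟶ Y} (h : ∀ x, g.f x = g'.f x) : g = g' :=
  Hom.ext' _ _ _ _ (ConcreteCategory.hom_ext _ _ h)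

theorem IsAlgHom.extend {X Y : T.Algebra} {h : X.A → Y.A} (hh : IsAlgHom X Y h) {I : Type u}
    (f : I → X.A) (φ : T.obj I) : h (X.extend f φ) = Y.extend (fun i => h (f i)) φ :=
  (hh _).trans (Y.extend_map (↾f) h φ)

theorem IsAlgHom.id (X : T.Algebra) : IsAlgHom X X fun x => x :=
  fun φ => (X.extend_self φ).symm

theorem IsAlgHom.comp {X Y Z : T.Algebra} {h : Y.A → Z.A} {g : X.A → Y.A}
    (hh : IsAlgHom Y Z h) (hg : IsAlgHom X Y g) : IsAlgHom X Z fun x => h (g x) :=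
  fun φ => (congrArg h (hg φ)).trans (hh.extend g φ)

theorem isAlgHom_extend (Z : T.Algebra) {I : Type u} (f : I → Z.A) :
    IsAlgHom (T.free.obj I) Z (Z.extend f) :=
  Z.extend_mul f

theorem extend_free_unit {I : Type u} (φ : T.obj I) :
    (T.free.obj I).extend (fun i => T.η.app I i) φ = φ :=
  ConcreteCategory.congr_hom (T.right_unit I) φ

/-- By the right unit law, every element of `T I` is a combination of generators, with itself as
coefficients. -/
theorem IsAlgHom.free_ext {I : Type u} {Z : T.Algebra} {h h' : T.obj I → Z.A}
    (hh : IsAlgHom (T.free.obj I) Z h) (hh' : IsAlgHom (T.free.obj I) Z h')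
    (H : ∀ i, h (T.η.app I i) = h' (T.η.app I i)) (φ : T.obj I) : h φ = h' φ := by
  have e := hh.extend (fun i => T.η.app I i) φ
  have e' := hh'.extend (fun i => T.η.app I i) φ
  rw [extend_free_unit] at e e'
  rw [e, e']
  simp only [H]

end Algebra

/-- A monad on the category of types is commutative if the two ways of combining elements of `T I`
and `T J` into an element of `T (I × J)` agree. -/
class Commutative (T : Monad (Type u)) : Prop where
  comm {I J : Type u} (φ : T.obj I) (ψ : T.obj J) :
    (T.free.obj (I × J)).extend (fun i => T.map (↾fun j => (i, j)) ψ) φ =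
      (T.free.obj (I × J)).extend (fun j => T.map (↾fun i => (i, j)) φ) ψ

namespace Algebra

/-- The Fubini rule. The class `Commutative` states the universal case, with values in the free
algebra on `I × J`; the general case is its image under the homomorphism extending `k`. -/
theorem extend_comm [T.Commutative] (Z : T.Algebra) {I J : Type u} (k : I → J → Z.A)
    (φ : T.obj I) (ψ : T.obj J) :
    Z.extend (fun i => Z.extend (fun j => k i j) ψ) φ =
      Z.extend (fun j => Z.extend (fun i => k i j) φ) ψ := by
  have h := congrArg (Z.extend fun p : I × J => k p.1 p.2) (Commutative.comm φ ψ)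
  have e := (isAlgHom_extend Z fun p : I × J => k p.1 p.2).extend
    (fun i => T.map (↾fun j => (i, j)) ψ) φ
  have e' := (isAlgHom_extend Z fun p : I × J => k p.1 p.2).extend
    (fun j => T.map (↾fun i => (i, j)) φ) ψ
  have H := e.symm.trans (h.trans e')
  simp only [extend_map] at H
  exact H

/-! ### Bilinear maps and the tensor product -/

/-- A function of two variables is bilinear if it is a homomorphism in each variable. -/
structure IsBilinear (X Y Z : T.Algebra) (f : X.A → Y.A → Z.A) : Prop where
  left (y : Y.A) : IsAlgHom X Z fun x => f x y
  right (x : X.A) : IsAlgHom Y Z (f x)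

theorem IsBilinear.comp {X Y Z W : T.Algebra} {f : X.A → Y.A → Z.A} (hf : IsBilinear X Y Z f)
    {g : Z.A → W.A} (hg : IsAlgHom Z W g) : IsBilinear X Y W fun x y => g (f x y) where
  left y := hg.comp (hf.left y)
  right x := hg.comp (hf.right x)

theorem IsBilinear.precomp {X X' Y Y' Z : T.Algebra} {f : X.A → Y.A → Z.A}
    (hf : IsBilinear X Y Z f) {g : X'.A → X.A} (hg : IsAlgHom X' X g) {h : Y'.A → Y.A}
    (hh : IsAlgHom Y' Y h) : IsBilinear X' Y' Z fun x y => f (g x) (h y) where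
  left y := (hf.left (h y)).comp hg
  right x := (hf.right (g x)).comp hh

theorem IsBilinear.swap {X Y Z : T.Algebra} {f : X.A → Y.A → Z.A} (hf : IsBilinear X Y Z f) :
    IsBilinear Y X Z fun y x => f x y where
  left := hf.right
  right := hf.left

/-- Two elements of `T (X × Y)` are related if no bilinear map distinguishes them. -/
def tensorSetoid (X Y : T.Algebra) : Setoid (T.obj (X.A × Y.A)) where
  r φ ψ := ∀ (Z : T.Algebra) (f : X.A → Y.A → Z.A), IsBilinear X Y Z f →
    Z.extend (fun p => f p.1 p.2) φ = Z.extend (fun p => f p.1 p.2) ψ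
  iseqv :=
    { refl := fun _ _ _ _ => rfl
      symm := fun h Z f hf => (h Z f hf).symm
      trans := fun h h' Z f hf => (h Z f hf).trans (h' Z f hf) }

/-- The function on the carrier of the tensor product induced by a bilinear map. -/
def tensorLift {X Y Z : T.Algebra} (f : X.A → Y.A → Z.A) (hf : IsBilinear X Y Z f) :
    _root_.Quotient (tensorSetoid X Y) → Z.A :=
  _root_.Quotient.lift (Z.extend fun p => f p.1 p.2) fun _ _ h => h Z f hf

/-- The substitute for computing with representatives: equality in the quotient is tested in all
algebras at once. -/
theorem tensor_eq_of_lift {X Y : T.Algebra} {q q' : _root_.Quotient (tensorSetoid X Y)}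
    (h : ∀ (Z : T.Algebra) (f : X.A → Y.A → Z.A) (hf : IsBilinear X Y Z f),
      tensorLift f hf q = tensorLift f hf q') : q = q' := by
  induction q using _root_.Quotient.ind
  induction q' using _root_.Quotient.ind
  exact _root_.Quotient.sound fun Z f hf => h Z f hf

/-- The structure map of the tensor product. -/
noncomputable def tensorStr (X Y : T.Algebra) (Φ : T.obj (_root_.Quotient (tensorSetoid X Y))) :
    _root_.Quotient (tensorSetoid X Y) :=
  _root_.Quotient.mk _ ((T.free.obj (X.A × Y.A)).extend (fun q => q.out) Φ)

/-- The lift of `f` takes the same value on every representative, so the choice made by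
`Quotient.out` in `tensorStr` is invisible to it. -/
theorem tensorLift_str {X Y Z : T.Algebra} (f : X.A → Y.A → Z.A) (hf : IsBilinear X Y Z f)
    (Φ : T.obj (_root_.Quotient (tensorSetoid X Y))) :
    tensorLift f hf (tensorStr X Y Φ) = Z.extend (tensorLift f hf) Φ := by
  refine ((isAlgHom_extend Z _).extend _ Φ).trans (congrArg (fun g => Z.extend g Φ) ?_)
  funext q
  conv_rhs => rw [← q.out_eq]
  rfl

/-- The tensor product of two algebras. -/
noncomputable def tensor (X Y : T.Algebra) : T.Algebra where
  A := _root_.Quotient (tensorSetoid X Y)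
  a := ↾(tensorStr X Y)
  -- Under each lift, both algebra laws turn into the corresponding laws of `Z`.
  unit := by
    ext q
    refine tensor_eq_of_lift fun Z f hf => ?_
    exact (tensorLift_str f hf _).trans (Z.extend_unit _ q)
  assoc := by
    ext Φ
    refine tensor_eq_of_lift fun Z f hf => ?_
    refine ((tensorLift_str f hf _).trans (Z.extend_mul _ Φ)).trans ?_
    refine Eq.trans ?_ ((tensorLift_str f hf _).trans (Z.extend_map _ _ Φ)).symm
    exact congrArg (fun g => Z.extend g Φ) (funext fun φ => (tensorLift_str f hf φ).symm)

/-- The universal bilinear map. -/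
noncomputable def tmul {X Y : T.Algebra} (x : X.A) (y : Y.A) : (tensor X Y).A :=
  _root_.Quotient.mk (tensorSetoid X Y) (T.η.app (X.A × Y.A) (x, y))

theorem isAlgHom_tensorLift {X Y Z : T.Algebra} (f : X.A → Y.A → Z.A) (hf : IsBilinear X Y Z f) :
    IsAlgHom (tensor X Y) Z (tensorLift f hf) :=
  tensorLift_str f hf

theorem tensorLift_tmul {X Y Z : T.Algebra} (f : X.A → Y.A → Z.A) (hf : IsBilinear X Y Z f)
    (x : X.A) (y : Y.A) : tensorLift f hf (tmul x y) = f x y :=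
  Z.extend_unit _ (x, y)

theorem isBilinear_tmul (X Y : T.Algebra) : IsBilinear X Y (tensor X Y) tmul where
  left y φ := by
    refine tensor_eq_of_lift fun Z f hf => ?_
    rw [tensorLift_tmul, (isAlgHom_tensorLift f hf).extend]
    simp only [tensorLift_tmul]
    exact hf.left y φ
  right x φ := by
    refine tensor_eq_of_lift fun Z f hf => ?_
    rw [tensorLift_tmul, (isAlgHom_tensorLift f hf).extend]
    simp only [tensorLift_tmul]
    exact hf.right x φ

/-- Pure tensors generate: the class of a formal combination of pairs is that combination evaluated
on pure tensors. -/
theorem tensor_mk_eq {X Y : T.Algebra} (φ : T.obj (X.A × Y.A)) :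
    _root_.Quotient.mk (tensorSetoid X Y) φ = (tensor X Y).extend (fun p => tmul p.1 p.2) φ := by
  refine tensor_eq_of_lift fun Z f hf => ?_
  rw [(isAlgHom_tensorLift f hf).extend]
  simp only [tensorLift_tmul]
  rfl

theorem IsAlgHom.tensor_ext {X Y Z : T.Algebra} {h h' : (tensor X Y).A → Z.A}
    (hh : IsAlgHom (tensor X Y) Z h) (hh' : IsAlgHom (tensor X Y) Z h')
    (H : ∀ x y, h (tmul x y) = h' (tmul x y)) (q : (tensor X Y).A) : h q = h' q := by
  obtain ⟨φ, rfl⟩ := _root_.Quotient.exists_rep q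
  rw [tensor_mk_eq, hh.extend, hh'.extend]
  simp only [H]

theorem tensor_hom_ext {X Y Z : T.Algebra} {g g' : tensor X Y ⟶ Z}
    (H : ∀ x y, g.f (tmul x y) = g'.f (tmul x y)) : g = g' :=
  hom_ext_apply (IsAlgHom.tensor_ext g.isAlgHom g'.isAlgHom H)

/-- The morphism of algebras induced by a bilinear map. -/
noncomputable def tensorDesc {X Y Z : T.Algebra} (f : X.A → Y.A → Z.A) (hf : IsBilinear X Y Z f) :
    tensor X Y ⟶ Z :=
  (isAlgHom_tensorLift f hf).toHom

@[simp]
theorem tensorDesc_tmul {X Y Z : T.Algebra} (f : X.A → Y.A → Z.A) (hf : IsBilinear X Y Z f)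
    (x : X.A) (y : Y.A) : (tensorDesc f hf).f (tmul x y) = f x y :=
  tensorLift_tmul f hf x y

/-- The tensor product of two morphisms of algebras. -/
noncomputable def tensorMap {X X' Y Y' : T.Algebra} (f : X ⟶ X') (g : Y ⟶ Y') :
    tensor X Y ⟶ tensor X' Y' :=
  tensorDesc (fun x y => tmul (f.f x) (g.f y))
    ((isBilinear_tmul X' Y').precomp f.isAlgHom g.isAlgHom)

@[simp]
theorem tensorMap_tmul {X X' Y Y' : T.Algebra} (f : X ⟶ X') (g : Y ⟶ Y') (x : X.A) (y : Y.A) :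
    (tensorMap f g).f (tmul x y) = tmul (f.f x) (g.f y) :=
  tensorDesc_tmul _ _ x y

theorem tensor_hom_ext_left {X Y Z W : T.Algebra} {g g' : tensor (tensor X Y) Z ⟶ W}
    (H : ∀ x y z, g.f (tmul (tmul x y) z) = g'.f (tmul (tmul x y) z)) : g = g' :=
  tensor_hom_ext fun q z =>
    IsAlgHom.tensor_ext (g.isAlgHom.comp ((isBilinear_tmul _ _).left z))
      (g'.isAlgHom.comp ((isBilinear_tmul _ _).left z)) (fun x y => H x y z) q

theorem tensor_hom_ext_right {X Y Z W : T.Algebra} {g g' : tensor X (tensor Y Z) ⟶ W}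
    (H : ∀ x y z, g.f (tmul x (tmul y z)) = g'.f (tmul x (tmul y z))) : g = g' :=
  tensor_hom_ext fun x q =>
    IsAlgHom.tensor_ext (g.isAlgHom.comp ((isBilinear_tmul _ _).right x))
      (g'.isAlgHom.comp ((isBilinear_tmul _ _).right x)) (fun y z => H x y z) q

/-! ### Commutativity and multilinear maps -/

section Commutative

variable [T.Commutative]

/-- Pointwise extensions of homomorphisms are homomorphisms. -/
theorem IsAlgHom.pointwise {Y Z : T.Algebra} {I : Type u} {k : I → Y.A → Z.A}
    (hk : ∀ i, IsAlgHom Y Z (k i)) (φ : T.obj I) :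
    IsAlgHom Y Z fun y => Z.extend (fun i => k i y) φ := fun ψ => by
  -- Once each `k i` is moved past the structure map, what remains is the interchange of `φ` and
  -- `ψ`.
  simp only [fun i => hk i ψ]
  exact extend_comm Z k φ ψ

/-- For fixed `φ`, both sides of the homomorphism law in the second variable are homomorphisms in
`q`, the right one by `IsAlgHom.pointwise`; hence pure tensors suffice. -/
theorem isBilinear_of_tmul_left {X Y Z W : T.Algebra} {k : (tensor X Y).A → Z.A → W.A}
    (hl : ∀ z, IsAlgHom (tensor X Y) W fun q => k q z)
    (hr : ∀ x y, IsAlgHom Z W (k (tmul x y))) : IsBilinear (tensor X Y) Z W k where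
  left := hl
  right q φ :=
    IsAlgHom.tensor_ext (hl (Z.a φ)) (IsAlgHom.pointwise hl φ) (fun x y => hr x y φ) q

theorem isBilinear_of_tmul_right {X Y Z W : T.Algebra} {k : X.A → (tensor Y Z).A → W.A}
    (hl : ∀ x, IsAlgHom (tensor Y Z) W (k x))
    (hr : ∀ y z, IsAlgHom X W fun x => k x (tmul y z)) : IsBilinear X (tensor Y Z) W k :=
  (isBilinear_of_tmul_left (k := fun q x => k x q) hl hr).swap

theorem isBilinear_extend_const (X : T.Algebra) :
    IsBilinear (T.free.obj PUnit) X X fun φ x => X.extend (fun _ => x) φ where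
  left x := isAlgHom_extend X fun _ => x
  right φ := IsAlgHom.pointwise (fun _ => IsAlgHom.id X) φ

/-- The morphism `(X ⊗ Y) ⊗ Z ⟶ X ⊗ (Y ⊗ Z)`. -/
noncomputable def assocHom (X Y Z : T.Algebra) :
    tensor (tensor X Y) Z ⟶ tensor X (tensor Y Z) :=
  tensorDesc
    (fun q z => (tensorDesc (fun x y => tmul x (tmul y z))
      ((isBilinear_tmul _ _).precomp (IsAlgHom.id X) ((isBilinear_tmul Y Z).left z))).f q)
    (isBilinear_of_tmul_left (fun _ => Hom.isAlgHom _) fun x y => by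
      simp only [tensorDesc_tmul]
      exact ((isBilinear_tmul X _).right x).comp ((isBilinear_tmul Y Z).right y))

/-- The morphism `X ⊗ (Y ⊗ Z) ⟶ (X ⊗ Y) ⊗ Z`. -/
noncomputable def assocInv (X Y Z : T.Algebra) :
    tensor X (tensor Y Z) ⟶ tensor (tensor X Y) Z :=
  tensorDesc
    (fun x q => (tensorDesc (fun y z => tmul (tmul x y) z)
      ((isBilinear_tmul _ _).precomp ((isBilinear_tmul X Y).right x) (IsAlgHom.id Z))).f q)
    (isBilinear_of_tmul_right (fun _ => Hom.isAlgHom _) fun y z => by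
      simp only [tensorDesc_tmul]
      exact ((isBilinear_tmul _ Z).left z).comp ((isBilinear_tmul X Y).left y))

@[simp]
theorem assocHom_tmul {X Y Z : T.Algebra} (x : X.A) (y : Y.A) (z : Z.A) :
    (assocHom X Y Z).f (tmul (tmul x y) z) = tmul x (tmul y z) := by
  simp [assocHom]

@[simp]
theorem assocInv_tmul {X Y Z : T.Algebra} (x : X.A) (y : Y.A) (z : Z.A) :
    (assocInv X Y Z).f (tmul x (tmul y z)) = tmul (tmul x y) z := by
  simp [assocInv]

end Commutative
theorem isAlgHom_map {I J : Type u} (g : I ⟶ J) :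
    IsAlgHom (T.free.obj I) (T.free.obj J) (T.map g) :=
  (T.free.map g).isAlgHom

theorem map_unit {I J : Type u} (g : I ⟶ J) (i : I) :
    T.map g (T.η.app I i) = T.η.app J (g i) :=
  (ConcreteCategory.congr_hom (T.η.naturality g) i).symm

section Commutative

variable [T.Commutative]

/-! ### The symmetric monoidal structure -/

/-- The associator of the tensor product. -/
noncomputable def tensorAssoc (X Y Z : T.Algebra) :
    tensor (tensor X Y) Z ≅ tensor X (tensor Y Z) where
  hom := assocHom X Y Z
  inv := assocInv X Y Z
  hom_inv_id := tensor_hom_ext_left fun _ _ _ => by simp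
  inv_hom_id := tensor_hom_ext_right fun _ _ _ => by simp

/-- The symmetry of the tensor product. -/
noncomputable def tensorComm (X Y : T.Algebra) : tensor X Y ⟶ tensor Y X :=
  tensorDesc (fun x y => tmul y x) (isBilinear_tmul Y X).swap

omit [T.Commutative] in
@[simp]
theorem tensorComm_tmul {X Y : T.Algebra} (x : X.A) (y : Y.A) :
    (tensorComm X Y).f (tmul x y) = tmul y x :=
  tensorDesc_tmul _ _ x y

omit [T.Commutative] in
theorem free_tensor_hom_ext {I : Type u} {X Z : T.Algebra} {g g' : tensor (T.free.obj I) X ⟶ Z}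
    (H : ∀ (i : I) (x : X.A), g.f (tmul (X := T.free.obj I) (T.η.app I i) x) =
      g'.f (tmul (X := T.free.obj I) (T.η.app I i) x)) : g = g' :=
  tensor_hom_ext fun φ x =>
    IsAlgHom.free_ext (g.isAlgHom.comp ((isBilinear_tmul _ X).left x))
      (g'.isAlgHom.comp ((isBilinear_tmul _ X).left x)) (fun i => H i x) φ

omit [T.Commutative] in
theorem free_tensor_free_hom_ext {I J : Type u} {Z : T.Algebra}
    {g g' : tensor (T.free.obj I) (T.free.obj J) ⟶ Z}
    (H : ∀ (i : I) (j : J),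
      g.f (tmul (X := T.free.obj I) (Y := T.free.obj J) (T.η.app I i) (T.η.app J j)) =
        g'.f (tmul (X := T.free.obj I) (Y := T.free.obj J) (T.η.app I i) (T.η.app J j))) :
    g = g' :=
  free_tensor_hom_ext fun i ψ =>
    IsAlgHom.free_ext (g.isAlgHom.comp ((isBilinear_tmul (T.free.obj I) (T.free.obj J)).right _))
      (g'.isAlgHom.comp ((isBilinear_tmul (T.free.obj I) (T.free.obj J)).right _))
      (fun j => H i j) ψ

/-- The action of the free algebra on one point on an algebra. -/
noncomputable def unitAct (X : T.Algebra) : tensor (T.free.obj PUnit) X ⟶ X :=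
  tensorDesc _ (isBilinear_extend_const X)

@[simp]
theorem unitAct_tmul {X : T.Algebra} (φ : (T.free.obj PUnit).A) (x : X.A) :
    (unitAct X).f (tmul φ x) = X.extend (fun _ : PUnit => x) φ :=
  tensorDesc_tmul _ _ φ x

/-- The left unitor of the tensor product. -/
noncomputable def tensorLeftUnitor (X : T.Algebra) : tensor (T.free.obj PUnit) X ≅ X where
  hom := unitAct X
  inv := ((isBilinear_tmul (T.free.obj PUnit) X).right (T.η.app PUnit PUnit.unit)).toHom
  -- Only the generator of the free algebra on a point needs checking, and it acts as the identity.
  hom_inv_id := free_tensor_hom_ext fun _ _ =>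
    congrArg (tmul (X := T.free.obj PUnit) (T.η.app PUnit PUnit.unit))
      ((unitAct_tmul _ _).trans (X.extend_unit _ _))
  inv_hom_id := hom_ext_apply fun _ => (unitAct_tmul _ _).trans (X.extend_unit _ _)

/-- The right unitor of the tensor product. -/
noncomputable def tensorRightUnitor (X : T.Algebra) : tensor X (T.free.obj PUnit) ≅ X where
  hom := tensorComm _ _ ≫ (tensorLeftUnitor X).hom
  inv := (tensorLeftUnitor X).inv ≫ tensorComm _ _
  hom_inv_id := by
    rw [Category.assoc, Iso.hom_inv_id_assoc]
    exact tensor_hom_ext fun x φ => by simp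
  inv_hom_id := by
    rw [Category.assoc, ← Category.assoc (tensorComm _ _),
      show tensorComm (T.free.obj PUnit) X ≫ tensorComm _ _ = 𝟙 _ from
        tensor_hom_ext fun φ x => by simp,
      Category.id_comp, Iso.inv_hom_id]

noncomputable scoped instance monoidalCategoryStruct : MonoidalCategoryStruct T.Algebra where
  tensorObj := tensor
  whiskerLeft X _ _ g := tensorMap (𝟙 X) g
  whiskerRight f Y := tensorMap f (𝟙 Y)
  tensorHom := tensorMap
  tensorUnit := T.free.obj PUnit
  associator := tensorAssoc
  leftUnitor := tensorLeftUnitor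
  rightUnitor := tensorRightUnitor

/-- The universal bilinear map, with values in the monoidal product. -/
noncomputable def tprod {X Y : T.Algebra} (x : X.A) (y : Y.A) : (X ⊗ Y).A :=
  tmul x y

/-- The action of the elements of the monoidal unit on an algebra. -/
def unitSMul {X : T.Algebra} (φ : (𝟙_ T.Algebra).A) (x : X.A) : X.A :=
  X.extend (fun _ : PUnit => x) φ

section

variable {X X' Y Y' Z W : T.Algebra}

theorem isBilinear_tprod (X Y : T.Algebra) : IsBilinear X Y (X ⊗ Y) tprod :=
  isBilinear_tmul X Y

/-- Homomorphisms are linear over the unit algebra. This gives naturality of the unitors and,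
applied to `tprod` in each variable, the triangle. -/
theorem IsAlgHom.map_unitSMul {h : X.A → Y.A} (hh : IsAlgHom X Y h) (φ : (𝟙_ T.Algebra).A)
    (x : X.A) : h (unitSMul φ x) = unitSMul φ (h x) :=
  hh.extend _ φ

theorem tprod_hom_ext {g g' : X ⊗ Y ⟶ Z}
    (H : ∀ x y, g.f (tprod x y) = g'.f (tprod x y)) : g = g' :=
  tensor_hom_ext H

theorem tprod_hom_ext_left {g g' : (X ⊗ Y) ⊗ Z ⟶ W}
    (H : ∀ x y z, g.f (tprod (tprod x y) z) = g'.f (tprod (tprod x y) z)) : g = g' :=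
  tensor_hom_ext_left H

theorem tprod_hom_ext_left_left {g g' : ((X ⊗ X') ⊗ Y) ⊗ Z ⟶ W}
    (H : ∀ x x' y z, g.f (tprod (tprod (tprod x x') y) z) =
      g'.f (tprod (tprod (tprod x x') y) z)) : g = g' :=
  tprod_hom_ext_left fun q y z =>
    IsAlgHom.tensor_ext
      (g.isAlgHom.comp (((isBilinear_tprod _ Z).left z).comp ((isBilinear_tprod _ Y).left y)))
      (g'.isAlgHom.comp (((isBilinear_tprod _ Z).left z).comp ((isBilinear_tprod _ Y).left y)))
      (fun x x' => H x x' y z) q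

theorem tprod_hom_ext_right {g g' : X ⊗ Y ⊗ Z ⟶ W}
    (H : ∀ x y z, g.f (tprod x (tprod y z)) = g'.f (tprod x (tprod y z))) : g = g' :=
  tensor_hom_ext_right H

@[simp]
theorem tensorHom_tprod (f : X ⟶ X') (g : Y ⟶ Y') (x : X.A) (y : Y.A) :
    (f ⊗ₘ g).f (tprod x y) = tprod (f.f x) (g.f y) :=
  tensorMap_tmul f g x y

@[simp]
theorem whiskerLeft_tprod (g : Y ⟶ Y') (x : X.A) (y : Y.A) :
    (X ◁ g).f (tprod x y) = tprod x (g.f y) :=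
  tensorMap_tmul (𝟙 X) g x y

@[simp]
theorem whiskerRight_tprod (f : X ⟶ X') (x : X.A) (y : Y.A) :
    (f ▷ Y).f (tprod x y) = tprod (f.f x) y :=
  tensorMap_tmul f (𝟙 Y) x y

@[simp]
theorem associator_hom_tprod (x : X.A) (y : Y.A) (z : Z.A) :
    (α_ X Y Z).hom.f (tprod (tprod x y) z) = tprod x (tprod y z) :=
  assocHom_tmul x y z

@[simp]
theorem associator_inv_tprod (x : X.A) (y : Y.A) (z : Z.A) :
    (α_ X Y Z).inv.f (tprod x (tprod y z)) = tprod (tprod x y) z :=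
  assocInv_tmul x y z

@[simp]
theorem leftUnitor_hom_tprod (φ : (𝟙_ T.Algebra).A) (x : X.A) :
    (λ_ X).hom.f (tprod φ x) = unitSMul φ x :=
  unitAct_tmul φ x

@[simp]
theorem rightUnitor_hom_tprod (x : X.A) (φ : (𝟙_ T.Algebra).A) :
    (ρ_ X).hom.f (tprod x φ) = unitSMul φ x :=
  (congrArg (unitAct X).f (tensorComm_tmul x φ)).trans (unitAct_tmul φ x)

end

noncomputable scoped instance monoidalCategory : MonoidalCategory T.Algebra where
  tensorHom_def f g := tprod_hom_ext fun x y => by simp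
  id_tensorHom_id X Y := tprod_hom_ext fun x y => by simp
  tensorHom_comp_tensorHom f f' g g' := tprod_hom_ext fun x y => by simp
  whiskerLeft_id X Y := tprod_hom_ext fun x y => by simp
  id_whiskerRight X Y := tprod_hom_ext fun x y => by simp
  associator_naturality f g h := tprod_hom_ext_left fun x y z => by simp
  leftUnitor_naturality f := tprod_hom_ext fun φ x => by
    simp [f.isAlgHom.map_unitSMul]
  rightUnitor_naturality f := tprod_hom_ext fun x φ => by
    simp [f.isAlgHom.map_unitSMul]
  pentagon W X Y Z := tprod_hom_ext_left_left fun w x y z => by simp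
  triangle X Y := tprod_hom_ext_left fun x φ y => by
    simp [((isBilinear_tprod X Y).left y).map_unitSMul, ((isBilinear_tprod X Y).right x).map_unitSMul]

/-- The symmetry of the monoidal product. -/
noncomputable def tensorCommIso (X Y : T.Algebra) : X ⊗ Y ≅ Y ⊗ X where
  hom := tensorComm X Y
  inv := tensorComm Y X
  hom_inv_id := tensor_hom_ext fun x y =>
    (congrArg (tensorComm Y X).f (tensorComm_tmul x y)).trans (tensorComm_tmul y x)
  inv_hom_id := tensor_hom_ext fun y x =>
    (congrArg (tensorComm X Y).f (tensorComm_tmul y x)).trans (tensorComm_tmul x y)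

@[simp]
theorem tensorCommIso_hom_tprod {X Y : T.Algebra} (x : X.A) (y : Y.A) :
    (tensorCommIso X Y).hom.f (tprod x y) = tprod y x :=
  tensorComm_tmul x y

noncomputable scoped instance symmetricCategory : SymmetricCategory T.Algebra where
  braiding := tensorCommIso
  braiding_naturality_right _ _ _ f := tprod_hom_ext fun x y => by simp
  braiding_naturality_left f _ := tprod_hom_ext fun x y => by simp
  hexagon_forward X Y Z := tprod_hom_ext_left fun x y z => by simp
  hexagon_reverse X Y Z := tprod_hom_ext_right fun x y z => by simp
  symmetry X Y := (tensorCommIso X Y).hom_inv_id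

@[simp]
theorem braiding_hom_tprod {X Y : T.Algebra} (x : X.A) (y : Y.A) :
    (β_ X Y).hom.f (tprod x y) = tprod y x :=
  tensorComm_tmul x y

/-! ### Internal homs -/

/-- The pointwise structure map on morphisms of algebras. -/
def internalHomStr {Y Z : T.Algebra} (Φ : T.obj (Y ⟶ Z)) : Y ⟶ Z :=
  (IsAlgHom.pointwise (fun g : Y ⟶ Z => g.isAlgHom) Φ).toHom

/-- The algebra of morphisms of algebras, with pointwise structure. -/
def internalHom (Y Z : T.Algebra) : T.Algebra where
  A := Y ⟶ Z
  a := ↾internalHomStr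
  unit := by
    refine ConcreteCategory.hom_ext _ _ fun g => ?_
    exact hom_ext_apply (g := internalHomStr (T.η.app (Y ⟶ Z) g)) (g' := g) fun y =>
      Z.extend_unit (fun g : Y ⟶ Z => g.f y) g
  assoc := by
    refine ConcreteCategory.hom_ext _ _ fun Φ => ?_
    exact hom_ext_apply (g := internalHomStr (T.μ.app (Y ⟶ Z) Φ))
      (g' := internalHomStr (T.map (↾internalHomStr) Φ)) fun y =>
      (Z.extend_mul (fun g : Y ⟶ Z => g.f y) Φ).trans
        (Z.extend_map (↾internalHomStr) (fun g : Y ⟶ Z => g.f y) Φ).symm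

theorem isAlgHom_eval {Y Z : T.Algebra} (y : Y.A) :
    IsAlgHom (internalHom Y Z) Z fun g : Y ⟶ Z => g.f y :=
  fun _ => rfl

/-- The evaluations are homomorphisms and jointly injective, so the law may be tested at each `y`.
-/
theorem isAlgHom_internalHom {X Y Z : T.Algebra} {h : X.A → (Y ⟶ Z)}
    (hh : ∀ y, IsAlgHom X Z fun x => (h x).f y) : IsAlgHom X (internalHom Y Z) h :=
  fun φ => hom_ext_apply fun y =>
    (hh y φ).trans ((isAlgHom_eval (Z := Z) y).extend h φ).symm

/-- The internal hom functor. -/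
def internalHomFunctor (Y : T.Algebra) : T.Algebra ⥤ T.Algebra where
  obj := internalHom Y
  map {Z W} k := (isAlgHom_internalHom (X := internalHom Y Z) (Z := W) (h := fun g => g ≫ k)
    fun y => k.isAlgHom.comp (isAlgHom_eval y)).toHom
  map_id Z := hom_ext_apply fun g : Y ⟶ Z => Category.comp_id g
  map_comp k l := hom_ext_apply fun g => (Category.assoc g k l).symm

/-- The morphism `X ⊗ Y ⟶ Z` given by a morphism from `Y` to the internal hom. -/
noncomputable def uncurry {X Y Z : T.Algebra} (g : Y ⟶ internalHom X Z) : X ⊗ Y ⟶ Z :=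
  tensorDesc (fun x y => Hom.f (A := X) (B := Z) (g.f y) x)
    { left := fun y => Hom.isAlgHom (X := X) (Y := Z) (g.f y)
      right := fun x => (isAlgHom_eval x).comp g.isAlgHom }

theorem uncurry_tprod {X Y Z : T.Algebra} (g : Y ⟶ internalHom X Z) (x : X.A) (y : Y.A) :
    (uncurry g).f (tprod x y) = Hom.f (A := X) (B := Z) (g.f y) x :=
  tensorDesc_tmul (fun x y => Hom.f (A := X) (B := Z) (g.f y) x)
    { left := fun y => Hom.isAlgHom (X := X) (Y := Z) (g.f y)
      right := fun x => (isAlgHom_eval x).comp g.isAlgHom } x y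

/-- Currying of morphisms of algebras. -/
noncomputable def curryEquiv (X Y Z : T.Algebra) : (X ⊗ Y ⟶ Z) ≃ (Y ⟶ internalHom X Z) where
  toFun g := (isAlgHom_internalHom
    (h := fun y => (g.isAlgHom.comp ((isBilinear_tprod X Y).left y)).toHom)
    fun x => g.isAlgHom.comp ((isBilinear_tprod X Y).right x)).toHom
  invFun := uncurry
  left_inv _ := tprod_hom_ext fun x y => uncurry_tprod _ x y
  right_inv g := hom_ext_apply fun y => hom_ext_apply (X := X) (Y := Z)
    fun x => uncurry_tprod g x y

noncomputable scoped instance monoidalClosed : MonoidalClosed T.Algebra where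
  closed X :=
    { rightAdj := internalHomFunctor X
      adj := Adjunction.mkOfHomEquiv
        { homEquiv := curryEquiv X
          homEquiv_naturality_left_symm := fun f g => tprod_hom_ext fun x y =>
            (uncurry_tprod (f ≫ g) x y).trans
              ((congrArg (uncurry g).f (whiskerLeft_tprod f x y)).trans
                (uncurry_tprod g x (f.f y))).symm
          homEquiv_naturality_right := fun _ _ => hom_ext_apply fun _ => rfl } }

/-! ### The free functor -/

/-- The bilinear map `T I × T J → T (I × J)`. -/
def pairing {I J : Type u} (φ : T.obj I) (ψ : T.obj J) : T.obj (I × J) :=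
  (T.free.obj (I × J)).extend (fun j => T.map (↾fun i => (i, j)) φ) ψ

/-- `pairing` extends freely in `ψ`, so only linearity in `φ` needs commutativity. -/
theorem isBilinear_pairing (I J : Type u) :
    IsBilinear (T.free.obj I) (T.free.obj J) (T.free.obj (I × J)) pairing where
  left ψ := IsAlgHom.pointwise (fun _ => isAlgHom_map _) ψ
  right _ := isAlgHom_extend _ _

omit [T.Commutative] in
theorem pairing_unit {I J : Type u} (i : I) (j : J) :
    pairing (T.η.app I i) (T.η.app J j) = T.η.app (I × J) (i, j) :=
  (extend_unit _ _ j).trans (map_unit _ i)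

/-- The morphism of algebras `T I ⊗ T J ⟶ T (I × J)`. -/
noncomputable def freeTensorHom (I J : Type u) :
    tensor (T.free.obj I) (T.free.obj J) ⟶ T.free.obj (I × J) :=
  tensorDesc _ (isBilinear_pairing I J)

/-- The morphism of algebras `T (I × J) ⟶ T I ⊗ T J`. -/
noncomputable def freeTensorInv (I J : Type u) :
    T.free.obj (I × J) ⟶ tensor (T.free.obj I) (T.free.obj J) :=
  (isAlgHom_extend _ fun p : I × J =>
    tmul (X := T.free.obj I) (Y := T.free.obj J) (T.η.app I p.1) (T.η.app J p.2)).toHom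

theorem freeTensorHom_tmul {I J : Type u} (φ : T.obj I) (ψ : T.obj J) :
    (freeTensorHom I J).f (tmul (X := T.free.obj I) (Y := T.free.obj J) φ ψ) = pairing φ ψ :=
  tensorDesc_tmul (X := T.free.obj I) (Y := T.free.obj J) _ _ φ ψ

theorem freeTensorHom_unit {I J : Type u} (i : I) (j : J) :
    (freeTensorHom I J).f
      (tmul (X := T.free.obj I) (Y := T.free.obj J) (T.η.app I i) (T.η.app J j)) =
      T.η.app (I × J) (i, j) :=
  (freeTensorHom_tmul _ _).trans (pairing_unit i j)

omit [T.Commutative] in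
theorem freeTensorInv_unit {I J : Type u} (i : I) (j : J) :
    (freeTensorInv (T := T) I J).f (T.η.app (I × J) (i, j)) =
      tmul (X := T.free.obj I) (Y := T.free.obj J) (T.η.app I i) (T.η.app J j) :=
  extend_unit (T := T) (tensor (T.free.obj I) (T.free.obj J)) (fun p : I × J =>
    tmul (X := T.free.obj I) (Y := T.free.obj J) (T.η.app I p.1) (T.η.app J p.2)) (i, j)

/-- The isomorphism `T I ⊗ T J ≅ T (I × J)` of algebras. -/
noncomputable def freeTensorIso (I J : Type u) :
    T.free.obj I ⊗ T.free.obj J ≅ T.free.obj (I ⊗ J) where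
  hom := freeTensorHom I J
  inv := freeTensorInv I J
  hom_inv_id := free_tensor_free_hom_ext fun i j =>
    (congrArg (freeTensorInv I J).f (freeTensorHom_unit i j)).trans (freeTensorInv_unit i j)
  inv_hom_id := hom_ext_apply <| IsAlgHom.free_ext (Hom.isAlgHom _) (Hom.isAlgHom _) fun p =>
    (congrArg (freeTensorHom I J).f (freeTensorInv_unit p.1 p.2)).trans
      (freeTensorHom_unit p.1 p.2)

/-- The image of an element under the unit of the monad. -/
def pure {I : Type u} (i : I) : (T.free.obj I).A :=
  T.η.app I i

@[simp]
theorem freeTensorIso_hom_pure {I J : Type u} (i : I) (j : J) :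
    (freeTensorIso (T := T) I J).hom.f (tprod (pure i) (pure j)) = pure (I := I ⊗ J) (i, j) :=
  freeTensorHom_unit i j

omit [T.Commutative] in
@[simp]
theorem free_map_pure {I J : Type u} (g : I ⟶ J) (i : I) :
    (T.free.map g).f (pure i) = pure (g i) :=
  map_unit g i

theorem unitSMul_pure {X : T.Algebra} (p : PUnit.{u + 1}) (x : X.A) :
    unitSMul (X := X) (pure (T := T) p) x = x :=
  X.extend_unit _ _

theorem free_tprod_hom_ext {I J : Type u} {Z : T.Algebra} {g g' : T.free.obj I ⊗ T.free.obj J ⟶ Z}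
    (H : ∀ i j, g.f (tprod (pure i) (pure j)) = g'.f (tprod (pure i) (pure j))) : g = g' :=
  free_tensor_free_hom_ext H

theorem free_tprod_hom_ext_left {I J K : Type u} {Z : T.Algebra}
    {g g' : (T.free.obj I ⊗ T.free.obj J) ⊗ T.free.obj K ⟶ Z}
    (H : ∀ i j k, g.f (tprod (tprod (pure i) (pure j)) (pure k)) =
      g'.f (tprod (tprod (pure i) (pure j)) (pure k))) : g = g' := by
  -- Replacing `T I ⊗ T J` by the isomorphic free algebra on `I × J` reduces three factors to two.
  have e : (freeTensorInv I J ▷ T.free.obj K) ≫ g = (freeTensorInv I J ▷ T.free.obj K) ≫ g' := by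
    refine free_tprod_hom_ext fun p k => ?_
    have hp : (freeTensorInv (T := T) I J).f (pure (I := I × J) p) =
      tprod (pure p.1) (pure p.2) := freeTensorInv_unit p.1 p.2
    simpa [hp] using H p.1 p.2 k
  have : IsIso (freeTensorInv (T := T) I J) := (freeTensorIso (T := T) I J).isIso_inv
  exact (cancel_epi _).1 e

/-- The free functor is strong monoidal. -/
noncomputable def freeCoreMonoidal : T.free.CoreMonoidal where
  εIso := Iso.refl _
  μIso := freeTensorIso
  μIso_hom_natural_left f J := free_tprod_hom_ext fun i j => by
    -- The free functor stays folded so that `free_map_pure` can act on generators.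
    simp [-free_map_f, -free_obj_A]
    rfl
  μIso_hom_natural_right I f := free_tprod_hom_ext fun i j => by
    simp [-free_map_f, -free_obj_A]
    rfl
  associativity I J K := free_tprod_hom_ext_left fun i j k => by
    simp [-free_map_f, -free_obj_A]
    rfl
  left_unitality I := free_tprod_hom_ext (I := PUnit) fun p i => by
    refine (leftUnitor_hom_tprod (pure p) (pure i)).trans ((unitSMul_pure p (pure i)).trans ?_)
    refine ((congrArg (fun z => (T.free.map (λ_ I).hom).f ((freeTensorIso PUnit I).hom.f z))
      (whiskerRight_tprod (𝟙 (𝟙_ T.Algebra)) (pure p) (pure i))).trans ?_).symm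
    exact (congrArg (T.free.map (λ_ I).hom).f (freeTensorIso_hom_pure p i)).trans
      (free_map_pure _ (p, i))
  right_unitality I := free_tprod_hom_ext (J := PUnit) fun i p => by
    refine (rightUnitor_hom_tprod (pure i) (pure p)).trans ((unitSMul_pure p (pure i)).trans ?_)
    refine ((congrArg (fun z => (T.free.map (ρ_ I).hom).f ((freeTensorIso I PUnit).hom.f z))
      (whiskerLeft_tprod (𝟙 (𝟙_ T.Algebra)) (pure i) (pure p))).trans ?_).symm
    exact (congrArg (T.free.map (ρ_ I).hom).f (freeTensorIso_hom_pure i p)).trans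
      (free_map_pure _ (i, p))

/-- The strong monoidal structure of the free functor. -/
@[reducible]
noncomputable def freeMonoidal : T.free.Monoidal :=
  freeCoreMonoidal.toMonoidal

end Commutative
end Algebra

/-! ### The canonical strength and the classification of bimorphisms -/

open CategoryTheory.Monad.Algebra

variable (T)

/-- The strength `(x, φ) ↦ T (y ↦ (x, y)) φ` of a monad on the category of types. -/
def typeStrength : MonadStrength T where
  st X Y := ↾fun p : X × T.obj Y => T.map (↾fun y => (p.1, y)) p.2
  naturality {X X' Y Y'} f g := by
    ext ⟨x, φ⟩
    have h := ConcreteCategory.congr_hom (T.map_comp g (↾fun y => (f x, y))) φ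
    have h' := ConcreteCategory.congr_hom (T.map_comp (↾fun y => (x, y)) (f ⊗ₘ g)) φ
    exact h.symm.trans h'
  leftUnitor Y := by
    ext ⟨x, φ⟩
    have h := ConcreteCategory.congr_hom (T.map_comp (↾fun y => (x, y)) (λ_ Y).hom) φ
    exact h.symm.trans (ConcreteCategory.congr_hom (T.map_id Y) φ)
  associator X Y Z := by
    ext ⟨⟨x, y⟩, φ⟩
    have h := ConcreteCategory.congr_hom
      (T.map_comp (↾fun z => ((x, y), z)) (α_ X Y Z).hom) φ
    have h' := ConcreteCategory.congr_hom
      (T.map_comp (↾fun z : Z => (y, z)) (↾fun q : Y × Z => (x, q))) φ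
    exact h.symm.trans h'
  unit X Y := by
    ext ⟨x, y⟩
    exact map_unit (↾fun y : Y => (x, y)) y
  mul X Y := by
    ext ⟨x, Φ⟩
    have h := ConcreteCategory.congr_hom (T.μ.naturality (↾fun y : Y => (x, y))) Φ
    have h' := ConcreteCategory.congr_hom (T.map_comp (↾fun φ : T.obj Y => (x, φ))
      (↾fun p : X × T.obj Y => T.map (↾fun y => (p.1, y)) p.2)) Φ
    exact h.symm.trans (congrArg (T.μ.app (X × Y)) h')

variable {T}

theorem typeStrength_costrength_apply {X Y : Type u} (φ : T.obj X) (y : Y) :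
    (typeStrength T).costrength X Y (φ, y) = T.map (↾fun x => (x, y)) φ :=
  (ConcreteCategory.congr_hom (T.map_comp (↾fun x => (y, x)) (β_ Y X).hom) φ).symm

theorem typeStrength_dst_apply {X Y : Type u} (φ : T.obj X) (ψ : T.obj Y) :
    (typeStrength T).dst X Y (φ, ψ) = pairing φ ψ := by
  refine ((T.free.obj (X × Y)).extend_map (↾fun y => (φ, y))
    (fun p => (typeStrength T).costrength X Y p) ψ).trans ?_
  exact congrArg (fun f => (T.free.obj (X × Y)).extend f ψ)
    (funext fun y => typeStrength_costrength_apply φ y)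

theorem typeStrength_isCommutative [T.Commutative] : (typeStrength T).IsCommutative := by
  intro X Y
  refine ConcreteCategory.hom_ext _ _ fun ⟨φ, ψ⟩ => ?_
  refine (typeStrength_dst_apply φ ψ).trans ((Commutative.comm φ ψ).symm.trans ?_)
  refine ((T.free.obj (X × Y)).extend_map (↾fun x => (x, ψ))
    (fun p => (typeStrength T).st X Y p) φ).symm.trans ?_
  exact congrArg ((T.free.obj (X × Y)).extend fun p => (typeStrength T).st X Y p)
    (typeStrength_costrength_apply φ ψ).symm

/-- At a point `(x, ψ)` the strength only inserts the constant `x`, so the first bimorphism equation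
is the homomorphism law of `f (x, -)`; the costrength gives the other variable. -/
theorem isBimorphism_typeStrength_iff {X Y Z : T.Algebra} (f : X.A ⊗ Y.A ⟶ Z.A) :
    (typeStrength T).IsBimorphism f ↔ IsBilinear X Y Z fun x y => f (x, y) := by
  have er (x : X.A) (ψ : T.obj Y.A) :
      ((typeStrength T).st X.A Y.A ≫ T.map f ≫ Z.a) (x, ψ) = Z.extend (fun y => f (x, y)) ψ :=
    Z.extend_map (↾fun y => (x, y)) (fun p => f p) ψ
  have el (φ : T.obj X.A) (y : Y.A) :
      ((typeStrength T).costrength X.A Y.A ≫ T.map f ≫ Z.a) (φ, y) =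
        Z.extend (fun x => f (x, y)) φ :=
    (congrArg (Z.extend fun p => f p) (typeStrength_costrength_apply φ y)).trans
      (Z.extend_map (↾fun x => (x, y)) (fun p => f p) φ)
  constructor
  · intro h
    exact
      { left := fun y φ => (ConcreteCategory.congr_hom (C := Type u) h.left ((φ, y) : T.obj X.A × Y.A)).symm.trans (el φ y)
        right := fun x ψ => (ConcreteCategory.congr_hom (C := Type u) h.right ((x, ψ) : X.A × T.obj Y.A)).symm.trans (er x ψ) }
  · intro h
    exact
      { left := ConcreteCategory.hom_ext _ _ fun p => (el p.1 p.2).trans (h.left p.2 p.1).symm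
        right := ConcreteCategory.hom_ext _ _ fun p => (er p.1 p.2).trans (h.right p.1 p.2).symm }

section Commutative

variable [T.Commutative]

/-- The universal bimorphism. -/
noncomputable def tprodHom (X Y : T.Algebra) : X.A ⊗ Y.A ⟶ (X ⊗ Y).A :=
  ↾fun p : X.A × Y.A => tprod p.1 p.2

/-- The tensor product classifies bimorphisms. -/
noncomputable def tensorCorepresentableBy (X Y : T.Algebra) :
    ((typeStrength T).bim X Y).CorepresentableBy (X ⊗ Y) where
  homEquiv :=
    { toFun := fun g => ⟨tprodHom X Y ≫ g.f, (isBimorphism_typeStrength_iff _).2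
        ((isBilinear_tprod X Y).comp g.isAlgHom)⟩
      invFun := fun f => tensorDesc (fun x y => f.1 (x, y))
        ((isBimorphism_typeStrength_iff _).1 f.2)
      left_inv := fun g => tensor_hom_ext fun x y =>
        tensorDesc_tmul (fun x y => g.f (tprod x y)) _ x y
      right_inv := fun f => Subtype.ext (ConcreteCategory.hom_ext _ _ fun p =>
        tensorDesc_tmul (fun x y => f.1 (x, y))
          ((isBimorphism_typeStrength_iff _).1 f.2) p.1 p.2) }
  homEquiv_comp _ _ := rfl

theorem tprodHom_naturality {X X' Y Y' : T.Algebra} (f : X ⟶ X') (g : Y ⟶ Y') :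
    tprodHom X Y ≫ (f ⊗ₘ g).f = (f.f ⊗ₘ g.f) ≫ tprodHom X' Y' :=
  ConcreteCategory.hom_ext _ _ fun p => tensorHom_tprod f g p.1 p.2

theorem tprodHom_associator (X Y Z : T.Algebra) :
    (tprodHom X Y ▷ Z.A) ≫ tprodHom (X ⊗ Y) Z ≫ (α_ X Y Z).hom.f =
      (α_ X.A Y.A Z.A).hom ≫ (X.A ◁ tprodHom Y Z) ≫ tprodHom X (Y ⊗ Z) :=
  ConcreteCategory.hom_ext _ _ fun p => associator_hom_tprod p.1.1 p.1.2 p.2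

theorem tprodHom_braiding (X Y : T.Algebra) :
    tprodHom X Y ≫ (β_ X Y).hom.f = (β_ X.A Y.A).hom ≫ tprodHom Y X :=
  ConcreteCategory.hom_ext _ _ fun p => braiding_hom_tprod p.1 p.2

theorem tprodHom_leftUnitor (X : T.Algebra) :
    tprodHom (T.free.obj (𝟙_ (Type u))) X ≫
        ((eqToHom (rfl : T.free.obj (𝟙_ (Type u)) = 𝟙_ T.Algebra) ▷ X) ≫ (λ_ X).hom).f =
      (typeStrength T).costrength (𝟙_ (Type u)) X.A ≫ T.map (λ_ X.A).hom ≫ X.a := by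
  -- The unit is the free algebra on a point by definition, so the `eqToHom` is an identity and its
  -- whiskering can be dropped.
  refine Eq.trans (congrArg (fun g => tprodHom _ X ≫ (g ≫ (λ_ X).hom).f)
    (MonoidalCategory.id_whiskerRight (𝟙_ T.Algebra) X)) ?_
  refine Eq.trans (congrArg (fun g => tprodHom _ X ≫ g.f) (Category.id_comp (λ_ X).hom)) ?_
  refine ConcreteCategory.hom_ext _ _ fun p => ?_
  refine (leftUnitor_hom_tprod p.1 p.2).trans (Eq.symm ?_)
  refine (congrArg (X.extend fun q => (λ_ X.A).hom q)
    (typeStrength_costrength_apply (X := PUnit) p.1 p.2)).trans ?_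
  exact X.extend_map (↾fun i : PUnit => (i, p.2)) (fun q => (λ_ X.A).hom q) p.1

theorem tprodHom_rightUnitor (X : T.Algebra) :
    tprodHom X (T.free.obj (𝟙_ (Type u))) ≫
        ((X ◁ eqToHom (rfl : T.free.obj (𝟙_ (Type u)) = 𝟙_ T.Algebra)) ≫ (ρ_ X).hom).f =
      (typeStrength T).st X.A (𝟙_ (Type u)) ≫ T.map (ρ_ X.A).hom ≫ X.a := by
  refine Eq.trans (congrArg (fun g => tprodHom X _ ≫ (g ≫ (ρ_ X).hom).f)
    (MonoidalCategory.whiskerLeft_id X (𝟙_ T.Algebra))) ?_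
  refine Eq.trans (congrArg (fun g => tprodHom X _ ≫ g.f) (Category.id_comp (ρ_ X).hom)) ?_
  refine ConcreteCategory.hom_ext _ _ fun p => ?_
  refine (rightUnitor_hom_tprod p.1 p.2).trans (Eq.symm ?_)
  exact X.extend_map (↾fun i : PUnit => (p.1, i)) (fun q => (ρ_ X.A).hom q) p.2

theorem tprodHom_freeTensorIso (X Y : Type u) :
    tprodHom (T.free.obj X) (T.free.obj Y) ≫ (freeTensorIso X Y).hom.f =
      (typeStrength T).dst X Y :=
  ConcreteCategory.hom_ext _ _ fun p =>
    (freeTensorHom_tmul p.1 p.2).trans (typeStrength_dst_apply p.1 p.2).symm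

end Commutative

end CategoryTheory.Monad

/-! ### Commutativity and the unit for the `V`-powerset monad -/

section VPowerset

open CategoryTheory.Monad CategoryTheory.Monad.Algebra

variable {V : Type u} [CommMonoid V] [CompleteLattice V] [IsQuantale V]

/-- Identifies the canonical strength with `u x ⊠ φ`: the fibre over `p` is `{p.2}` if `x = p.1` and
empty otherwise, where the supremum is `⊥`. -/
theorem vMap_prodMk {X Y : Type u}
    (x : X) (φ : Y → V) : vMap V (fun y => (x, y)) φ = vBox V (vUnit V x) φ := by
  funext p
  refine le_antisymm (iSup₂_le fun y hy => ?_) ?_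
  · subst hy
    simp [vBox, vUnit]
  · by_cases h : x = p.1
    · refine le_trans ?_ (le_iSup₂_of_le p.2 (by rw [h]) le_rfl)
      simp [vBox, vUnit, h]
    · simp [vBox, vUnit, h]

theorem vMap_mk_prod {X Y : Type u}
    (y : Y) (φ : X → V) : vMap V (fun x => (x, y)) φ = vBox V φ (vUnit V y) := by
  funext p
  refine le_antisymm (iSup₂_le fun x hx => ?_) ?_
  · subst hx
    simp [vBox, vUnit]
  · by_cases h : y = p.2
    · refine le_trans ?_ (le_iSup₂_of_le p.1 (by rw [h]) le_rfl)
      simp [vBox, vUnit, h]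
    · simp [vBox, vUnit, h]

theorem vPowersetMonad_free_extend {I J : Type u} (f : I → J → V) (φ : I → V) (j : J) :
    ((vPowersetMonad V).free.obj J).extend f φ j = ⨆ i, φ i * f i j :=
  v_iSup_map_mul (V := V) f φ fun ψ => ψ j

theorem iSup_mul_vMap_prodMk
    {I J : Type u} (φ : I → V) (ψ : J → V) (p : I × J) :
    (⨆ i, φ i * vMap V (fun j => (i, j)) ψ p) = φ p.1 * ψ p.2 := by
  simp only [vMap_prodMk, vBox, ← mul_assoc, ← Quantale.iSup_mul_distrib, v_iSup_mul_unit]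

/-- Here `φ p.1` must be moved past `ψ j`, which is where commutativity of `⊗` is used. -/
theorem iSup_mul_vMap_mk_prod
    {I J : Type u} (φ : I → V) (ψ : J → V) (p : I × J) :
    (⨆ j, ψ j * vMap V (fun i => (i, j)) φ p) = φ p.1 * ψ p.2 := by
  simp only [vMap_mk_prod, vBox, mul_left_comm _ (φ p.1), ← Quantale.mul_iSup_distrib,
    v_iSup_mul_unit]

/-- Both iterated suprema collapse to `φ p.1 ⊗ ψ p.2`. -/
instance : (vPowersetMonad V).Commutative where
  comm {I J} φ ψ := by
    funext p
    exact ((vPowersetMonad_free_extend (fun i => vMap V (fun j => (i, j)) ψ) φ p).trans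
      (iSup_mul_vMap_prodMk φ ψ p)).trans
      ((vPowersetMonad_free_extend (fun j => vMap V (fun i => (i, j)) φ) ψ p).trans
        (iSup_mul_vMap_mk_prod φ ψ p)).symm

variable (V) in
/-- Evaluation at the point, as an isomorphism of algebras. -/
noncomputable def vEvalIso :
    (vPowersetMonad V).free.obj (𝟙_ (Type u)) ≅ vSelfAlgebra V :=
  Algebra.isoMk
    { hom := ↾fun φ : PUnit.{u + 1} → V => φ PUnit.unit
      inv := ↾fun v : V => fun _ : PUnit.{u + 1} => v } (by
    refine ConcreteCategory.hom_ext _ _ fun Φ => ?_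
    exact v_iSup_map_mul (V := V) (fun φ : PUnit.{u + 1} → V => φ PUnit.unit) Φ fun v => v)

end VPowerset

theorem mainTheorem7 (V : Type u) [CommMonoid V] [CompleteLattice V] [IsQuantale V] :
    -- the monad is strong, with strength `(x, φ) ↦ u x ⊠ φ`, and commutative
    ∃ S : MonadStrength (vPowersetMonad V),
      (∀ (X Y : Type u) (x : X) (φ : Y → V), S.st X Y (x, φ) = vBox V (vUnit V x) φ) ∧
      S.IsCommutative ∧
      -- a symmetric closed monoidal structure on the category of algebras,
      ∃ (_ : MonoidalCategory (vPowersetMonad V).Algebra)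
        (_ : SymmetricCategory (vPowersetMonad V).Algebra)
        (_ : MonoidalClosed (vPowersetMonad V).Algebra)
        -- whose unit is the free algebra on the one-point set,
        (unit_eq : 𝟙_ (vPowersetMonad V).Algebra = (vPowersetMonad V).free.obj (𝟙_ (Type u)))
        -- for which the free functor is strong monoidal
        (F : (vPowersetMonad V).free.Monoidal)
        -- and which classifies bimorphisms:
        (R : ∀ X Y : (vPowersetMonad V).Algebra, (S.bim X Y).CorepresentableBy (X ⊗ Y))
        (π : ∀ X Y : (vPowersetMonad V).Algebra, X.A ⊗ Y.A ⟶ (X ⊗ Y).A),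
        -- `π X Y` is the universal bimorphism, and it is natural in `X` and `Y`,
        (∀ X Y, π X Y = ((R X Y).homEquiv (𝟙 (X ⊗ Y))).1) ∧
        (∀ {X X' Y Y' : (vPowersetMonad V).Algebra} (f : X ⟶ X') (g : Y ⟶ Y'),
          π X Y ≫ (f ⊗ₘ g).f = (f.f ⊗ₘ g.f) ≫ π X' Y') ∧
        -- the associator and the symmetry are induced by those of sets,
        (∀ X Y Z : (vPowersetMonad V).Algebra,
          (π X Y ▷ Z.A) ≫ π (X ⊗ Y) Z ≫ (α_ X Y Z).hom.f =
            (α_ X.A Y.A Z.A).hom ≫ (X.A ◁ π Y Z) ≫ π X (Y ⊗ Z)) ∧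
        (∀ X Y : (vPowersetMonad V).Algebra,
          π X Y ≫ (β_ X Y).hom.f = (β_ X.A Y.A).hom ≫ π Y X) ∧
        -- the unitors are induced by the strength,
        (∀ X : (vPowersetMonad V).Algebra,
          π ((vPowersetMonad V).free.obj (𝟙_ (Type u))) X ≫
              ((eqToHom unit_eq.symm ▷ X) ≫ (λ_ X).hom).f =
            S.costrength (𝟙_ (Type u)) X.A ≫ (vPowersetMonad V).map (λ_ X.A).hom ≫ X.a) ∧
        (∀ X : (vPowersetMonad V).Algebra,
          π X ((vPowersetMonad V).free.obj (𝟙_ (Type u))) ≫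
              ((X ◁ eqToHom unit_eq.symm) ≫ (ρ_ X).hom).f =
            S.st X.A (𝟙_ (Type u)) ≫ (vPowersetMonad V).map (ρ_ X.A).hom ≫ X.a) ∧
        -- the structure maps of the free functor are the canonical ones,
        Functor.LaxMonoidal.ε (vPowersetMonad V).free = eqToHom unit_eq ∧
        (∀ X Y : Type u,
          π ((vPowersetMonad V).free.obj X) ((vPowersetMonad V).free.obj Y) ≫
            (Functor.LaxMonoidal.μ (vPowersetMonad V).free X Y).f = S.dst X Y) ∧
        -- and evaluation at the point is an isomorphism of algebras from `P_V(1)` to `V`.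
        (∃ e : (vPowersetMonad V).free.obj (𝟙_ (Type u)) ≅ vSelfAlgebra V,
          ∀ φ : PUnit.{u + 1} → V, e.hom.f φ = φ PUnit.unit) := by
  refine ⟨Monad.typeStrength _, fun X Y x φ => vMap_prodMk x φ, Monad.typeStrength_isCommutative,
    Monad.Algebra.monoidalCategory, Monad.Algebra.symmetricCategory, Monad.Algebra.monoidalClosed,
    rfl, Monad.Algebra.freeMonoidal,
    Monad.tensorCorepresentableBy, Monad.tprodHom, fun X Y => rfl, Monad.tprodHom_naturality,
    Monad.tprodHom_associator, Monad.tprodHom_braiding, Monad.tprodHom_leftUnitor,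
    Monad.tprodHom_rightUnitor, rfl, Monad.tprodHom_freeTensorIso, vEvalIso V, fun _ => rfl⟩
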